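/- Let $m\in\mathbb N$ and let $\mathcal O(\mathbb C^m,0)$ be the space of germs at the origin of holomorphic maps $\mathbb C^m\to\mathbb C^m$ fixing $0$, with the inductive limit topology: the finest topology making continuous all the injections $X_\varepsilon\to\mathcal O(\mathbb C^m,0)$, $\varepsilon>0$, where $X_\varepsilon$ is the space of bounded holomorphic maps on the ball $\mathbb B_\varepsilon=\{\|z\|<\varepsilon\}$ fixing $0$, with the sup metric. Let $\nu$ be a Borel probability measure on $\mathcal O(\mathbb C^m,0)$ with compact support, let $\mu=\nu^{\infty}$ be the law of an i.i.d. sequence $\omega=(f_1,f_2,\dots)$ of germs with law $\nu$, and let $f^n_\omega=f_n\circ\dots\circ f_1$, $f^0_\omega=\mathrm{id}$. Assume that the origin lies in the random Fatou set, i.e. that for $\mu$-almost every $\omega$ the family $\{f^n_\omega\}_{n\ge 0}$ is normal in a neighbourhood of the origin. Then there is $R>0$ such that every germ in $\mathrm{supp}(\nu)$ is (represented by a map) holomorphic and bounded on $\mathbb B_R$. Fix any such $R$, regard the germs in $\mathrm{supp}(\nu)$ as maps on $\mathbb B_R$, and put \[ D_\omega=\{z : f^n_\omega(z)\in\mathbb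 B_R \text{ for all } n\ge 0\}, \] let $U_\omega$ be the connected component of $\mathrm{int}(D_\omega)$ containing $0$, and for $z\in U_\omega$ let \[ \mathbb W^s_\omega(z)=\{w\in U_\omega : \|f^n_\omega(z)-f^n_\omega(w)\|\to 0 \text{ as } n\to\infty\}. \] Then there exists $r>0$ such that for $\mu$-almost every $\omega$ the following holds: $0\in \mathrm{int}(D_\omega)$, so that $U_\omega$ is well defined, and there are a strictly increasing sequence $(n_k)$ of natural numbers and a map $g:U_\omega\to\mathbb C^m$ (both depending on $\omega$) such that $f^{n_k}_\omega\to g$ locally uniformly on $U_\omega$ and \[ \mathbb W^s_\omega(z)=\{w\in U_\omega : g(w)=g(z)\}\qquad\text{for every } z\in U_\omega \text{ with } \|g(z)\|\le r . \] -/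

import Mathlib

open Filter Topology MeasureTheory Metric Set
open scoped BoundedContinuousFunction

namespace RandomGerms

noncomputable section

/-- The space `ℂ^m` with its Euclidean norm. -/
abbrev Cm (m : ℕ) : Type := EuclideanSpace ℂ (Fin m)

/-- `𝒪(ℂ^m, 0)`: germs at the origin of holomorphic maps from `ℂ^m` to itself that fix the
origin. -/
def HolGerm (m : ℕ) : Type :=
  {φ : Germ (𝓝 (0 : Cm m)) (Cm m) //
    ∃ f : Cm m → Cm m, AnalyticAt ℂ f 0 ∧ f 0 = 0 ∧ (f : Germ (𝓝 (0 : Cm m)) (Cm m)) = φ}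

namespace HolGerm

variable {m : ℕ}

/-- The germ at the origin of a map that is holomorphic near the origin and fixes it. -/
def mk (f : Cm m → Cm m) (hf : AnalyticAt ℂ f 0) (h0 : f 0 = 0) : HolGerm m :=
  ⟨(f : Germ (𝓝 (0 : Cm m)) (Cm m)), f, hf, h0, rfl⟩

/-- The map `F` is a representative of the germ `f`. -/
def IsRep (f : HolGerm m) (F : Cm m → Cm m) : Prop :=
  (F : Germ (𝓝 (0 : Cm m)) (Cm m)) = f.1

theorem tendsto_zero (f : HolGerm m) : f.1.Tendsto (𝓝 (0 : Cm m)) := by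
  obtain ⟨φ, F, hF, h0, rfl⟩ := f
  have h : Tendsto F (𝓝 0) (𝓝 (F 0)) := hF.continuousAt
  rw [h0] at h
  exact h

/-- The germ of the identity map. -/
def id (m : ℕ) : HolGerm m := mk (fun z => z) analyticAt_id rfl

/-- The composition `g ∘ f` of two germs fixing the origin. -/
def comp (g f : HolGerm m) : HolGerm m :=
  ⟨g.1.compTendsto' f.1 f.tendsto_zero, by
    obtain ⟨φ, F, hF, hF0, rfl⟩ := f
    obtain ⟨ψ, G, hG, hG0, rfl⟩ := g
    refine ⟨G ∘ F, ?_, by simp [hF0, hG0], rfl⟩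
    exact AnalyticAt.comp (by rwa [hF0]) hF⟩

end HolGerm

/-- Extension by zero, to the whole space, of a map defined on the ball `B_ε`. -/
def extendZero {m : ℕ} {ε : ℝ} (F : ball (0 : Cm m) ε →ᵇ Cm m) : Cm m → Cm m :=
  open Classical in fun z => if h : z ∈ ball (0 : Cm m) ε then F ⟨z, h⟩ else 0

/-- The space `X_ε` of bounded holomorphic maps on the ball `B_ε` that fix the origin, with the
metric `sup_{B_ε} ‖F - G‖` of the bounded continuous functions. -/
abbrev BddHol (m : ℕ) (ε : ℝ) : Type :=
  {F : ball (0 : Cm m) ε →ᵇ Cm m //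
    AnalyticOnNhd ℂ (extendZero F) (ball 0 ε) ∧ extendZero F 0 = 0}

/-- The natural injection of `X_ε` into the space of germs. -/
def BddHol.toGerm {m : ℕ} (ε : Ioi (0 : ℝ)) (F : BddHol m ε) : HolGerm m :=
  HolGerm.mk (extendZero F.1) (F.2.1 0 (mem_ball_self ε.2)) F.2.2

/-- The inductive limit topology: the finest topology for which all the injections
`X_ε → 𝒪(ℂ^m, 0)`, `ε > 0`, are continuous. -/
instance (m : ℕ) : TopologicalSpace (HolGerm m) :=
  ⨆ ε : Ioi (0 : ℝ), TopologicalSpace.coinduced (BddHol.toGerm (m := m) ε) inferInstance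

instance (m : ℕ) : MeasurableSpace (HolGerm m) := borel (HolGerm m)

instance (m : ℕ) : BorelSpace (HolGerm m) := ⟨rfl⟩

/-- The random composition `f^n_ω = ω_{n-1} ∘ ⋯ ∘ ω_0`, as a germ. -/
def iterGerm {m : ℕ} (ω : ℕ → HolGerm m) : ℕ → HolGerm m
  | 0 => HolGerm.id m
  | n + 1 => (ω n).comp (iterGerm ω n)

/-- The family `{f^n_ω}` is normal near the origin: on some ball around the origin all its members
are defined and holomorphic, and every sequence of members has a subsequence that converges
locally uniformly on that ball. -/
def IsNormalNearZero {m : ℕ} (ω : ℕ → HolGerm m) : Prop :=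
  ∃ ρ > 0, ∃ F : ℕ → Cm m → Cm m,
    (∀ n, AnalyticOnNhd ℂ (F n) (ball 0 ρ) ∧ (iterGerm ω n).IsRep (F n)) ∧
    ∀ s : ℕ → ℕ, ∃ φ : ℕ → ℕ, StrictMono φ ∧ ∃ G : Cm m → Cm m,
      TendstoLocallyUniformlyOn (fun k => F (s (φ k))) G atTop (ball 0 ρ)

/-- The law `ν^∞` of an i.i.d. sequence of germs with law `ν`. -/
abbrev seqLaw {m : ℕ} (ν : Measure (HolGerm m)) [IsProbabilityMeasure ν] :
    Measure (ℕ → HolGerm m) :=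
  Measure.infinitePi fun _ : ℕ => ν

/-- The origin lies in the random Fatou set. -/
def OriginInRandomFatouSet {m : ℕ} (ν : Measure (HolGerm m)) [IsProbabilityMeasure ν] : Prop :=
  ∀ᵐ ω ∂(seqLaw ν), IsNormalNearZero ω

/-- Every germ in the support of `ν` is holomorphic and bounded on the ball `B_R`. -/
def BoundedOnBall {m : ℕ} (ν : Measure (HolGerm m)) (R : ℝ) : Prop :=
  ∀ f ∈ ν.support, ∃ F : Cm m → Cm m,
    AnalyticOnNhd ℂ F (ball 0 R) ∧ Bornology.IsBounded (F '' ball 0 R) ∧ f.IsRep F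

/-- The holomorphic map on `B_R` represented by the germ `f`. If there is one, its values on `B_R`
are unique by the identity principle; if there is none, the value is junk. -/
def HolGerm.onBall {m : ℕ} (R : ℝ) (f : HolGerm m) : Cm m → Cm m :=
  open Classical in
  if h : ∃ F : Cm m → Cm m, AnalyticOnNhd ℂ F (ball 0 R) ∧ f.IsRep F then h.choose else 0

/-- The point `f^n_ω(z)`, computed step by step with the germs regarded as maps on `B_R`; it is
meaningful as long as the previous points of the orbit stay in `B_R`. -/
def orbit {m : ℕ} (R : ℝ) (ω : ℕ → HolGerm m) : ℕ → Cm m → Cm m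
  | 0, z => z
  | n + 1, z => (ω n).onBall R (orbit R ω n z)

/-- `D_ω`, the set of all points whose whole orbit stays in `B_R`. -/
def orbitDomain {m : ℕ} (R : ℝ) (ω : ℕ → HolGerm m) : Set (Cm m) :=
  {z | ∀ n, orbit R ω n z ∈ ball (0 : Cm m) R}

/-- `U_ω`, the connected component containing the origin of the Fatou set `int D_ω`. -/
def fatouComponent {m : ℕ} (R : ℝ) (ω : ℕ → HolGerm m) : Set (Cm m) :=
  connectedComponentIn (interior (orbitDomain R ω)) 0

/-- The stable set `W^s_ω(z)`. -/
def stableSet {m : ℕ} (R : ℝ) (ω : ℕ → HolGerm m) (z : Cm m) : Set (Cm m) :=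
  {w ∈ fatouComponent R ω |
    Tendsto (fun n => ‖orbit R ω n z - orbit R ω n w‖) atTop (𝓝 0)}

end

end RandomGerms

namespace RandomGerms

/-! On `U_ω` all iterates are bounded by `R`, so Montel's theorem gives a limit map `g` along a
subsequence of any prescribed sequence of times. Points of one stable set have the same image under
any such `g`; the converse requires well-chosen times.

Normality at the origin, where every iterate vanishes, puts almost every `ω` in some set
`stableSeq`: all iterates map a small ball into the closed ball of radius `R / 2`. A countable
exhaustion yields one radius `3 * r`, independent of `ω`, for which this set has positive measure.
By Poincaré recurrence and Kolmogorov's zero-one law, almost every `ω` is shifted into it infinitely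
often, and the subsequence is taken among these return times. If `g w = g z` has norm at most `r`,
then at a late return time both points are close together and well inside the ball of radius `3 *
r`. All further iterates are `R / r`-Lipschitz there, so the two orbits stay close forever
(`norm_orbit_sub_le`, `exists_limit_stableSet_eq`).

The topology of the germ space enters three times: compact sets of germs live on a common ball; the
space is hereditarily Lindelöf, so the support has full measure; Taylor coefficients are continuous,
so `stableSeq` is measurable. -/

/-! ### Schwarz-type estimate and Montel's theorem -/

/-- A holomorphic map bounded by `M` on a ball of radius `s` is `2M/s`-Lipschitz at its centre. -/
theorem norm_sub_le_of_bounded_on_ball {E F : Type*} [NormedAddCommGroup E] [NormedSpace ℂ E]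
    [NormedAddCommGroup F] [NormedSpace ℂ F] {f : E → F} {c z : E} {s M : ℝ}
    (hf : DifferentiableOn ℂ f (ball c s)) (hM : ∀ w ∈ ball c s, ‖f w‖ ≤ M) (hz : z ∈ ball c s) :
    ‖f z - f c‖ ≤ 2 * M / s * ‖z - c‖ := by
  have hs : 0 < s := pos_of_mem_ball hz
  rw [← dist_eq_norm, ← dist_eq_norm]
  refine Complex.dist_le_div_mul_dist_of_mapsTo_ball hf (fun w hw => ?_) hz
  rw [mem_closedBall, dist_eq_norm]
  linarith [norm_sub_le (f w) (f c), hM w hw, hM c (mem_ball_self hs)]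

/-- **Montel's theorem**: a bounded sequence of holomorphic maps on an open set has a locally
uniformly convergent subsequence. -/
theorem exists_subseq_tendstoLocallyUniformlyOn {E F : Type*} [NormedAddCommGroup E]
    [NormedSpace ℂ E] [SecondCountableTopology E] [NormedAddCommGroup F] [NormedSpace ℂ F]
    [ProperSpace F] {U : Set E} (hU : IsOpen U) {f : ℕ → E → F} {M : ℝ}
    (hf : ∀ n, DifferentiableOn ℂ (f n) U) (hM : ∀ n, ∀ z ∈ U, ‖f n z‖ ≤ M) :
    ∃ φ : ℕ → ℕ, StrictMono φ ∧ ∃ g : E → F,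
      TendstoLocallyUniformlyOn (fun k => f (φ k)) g atTop U := by
  have equi : ∀ x ∈ U, ∀ ε > 0, ∃ δ > 0, ∀ y ∈ ball x δ, y ∈ U ∧ ∀ n, ‖f n y - f n x‖ ≤ ε := by
    intro x hx ε hε
    obtain ⟨s, hs, hsU⟩ := Metric.isOpen_iff.1 hU x hx
    have hM0 : 0 ≤ M := (norm_nonneg _).trans (hM 0 x hx)
    refine ⟨min s (ε * s / (2 * M + 1)), by positivity, fun y hy => ?_⟩
    have hys : y ∈ ball x s := ball_subset_ball (min_le_left _ _) hy
    refine ⟨hsU hys, fun n => ?_⟩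
    have h1 := norm_sub_le_of_bounded_on_ball ((hf n).mono hsU) (fun w hw => hM n w (hsU hw)) hys
    have h2 : ‖y - x‖ ≤ ε * s / (2 * M + 1) := by
      rw [← dist_eq_norm]
      exact (mem_ball.1 hy).le.trans (min_le_right _ _)
    calc ‖f n y - f n x‖ ≤ 2 * M / s * ‖y - x‖ := h1
      _ ≤ 2 * M / s * (ε * s / (2 * M + 1)) := by gcongr
      _ = ε * (2 * M / (2 * M + 1)) := by field_simp
      _ ≤ ε * 1 := by
        gcongr
        rw [div_le_one (by positivity)]
        linarith
      _ = ε := mul_one ε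
  obtain ⟨Q, hQc, hQd⟩ := TopologicalSpace.exists_countable_dense U
  have : Countable Q := hQc
  -- Compactness of a countable product of closed balls replaces the diagonal argument: one
  -- subsequence converges at every point of the dense set. Equicontinuity then carries convergence
  -- to all of `U`.
  have hcpt : IsCompact (Set.pi univ fun _ : Q => closedBall (0 : F) M) :=
    isCompact_univ_pi fun _ => isCompact_closedBall _ _
  obtain ⟨a, -, φ, hφ, ha⟩ := hcpt.tendsto_subseq (x := fun n (q : Q) => f n q.1.1)
    (fun n q _ => by simpa using hM n q.1.1 q.1.2)
  rw [tendsto_pi_nhds] at ha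
  have hconv : ∀ x ∈ U, ∃ b, Tendsto (fun k => f (φ k) x) atTop (𝓝 b) := by
    intro x hx
    refine cauchySeq_tendsto_of_complete (Metric.cauchySeq_iff'.2 fun ε hε => ?_)
    obtain ⟨δ, hδ, hδe⟩ := equi x hx (ε / 4) (by positivity)
    obtain ⟨q, hqQ, hqb⟩ := hQd.exists_mem_open
      (isOpen_ball.preimage continuous_subtype_val : IsOpen ((↑) ⁻¹' ball x δ : Set U))
      ⟨⟨x, hx⟩, mem_ball_self hδ⟩
    obtain ⟨N, hN⟩ := Metric.cauchySeq_iff'.1 (ha ⟨q, hqQ⟩).cauchySeq (ε / 4) (by positivity)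
    refine ⟨N, fun n hn => ?_⟩
    have h1 := (hδe q hqb).2 (φ n)
    have h2 := (hδe q hqb).2 (φ N)
    have h3 := hN n hn
    simp only [Function.comp_apply] at h3
    rw [← dist_eq_norm] at h1 h2
    have h4 := dist_triangle4 (f (φ n) x) (f (φ n) q) (f (φ N) q) (f (φ N) x)
    rw [dist_comm (f (φ n) x) (f (φ n) q)] at h4
    linarith
  choose! g hg using hconv
  refine ⟨φ, hφ, g, Metric.tendstoLocallyUniformlyOn_iff.2 fun ε hε x hx => ?_⟩
  obtain ⟨δ, hδ, hδe⟩ := equi x hx (ε / 4) (by positivity)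
  refine ⟨ball x δ, mem_nhdsWithin_of_mem_nhds (ball_mem_nhds _ hδ), ?_⟩
  filter_upwards [Metric.tendsto_nhds.1 (hg x hx) (ε / 4) (by positivity)] with n hn y hy
  obtain ⟨hyU, hye⟩ := hδe y hy
  have h1 : ‖g y - g x‖ ≤ ε / 4 :=
    le_of_tendsto ((hg y hyU).sub (hg x hx)).norm (Eventually.of_forall fun k => hye (φ k))
  have h2 := hye (φ n)
  rw [← dist_eq_norm] at h1 h2
  have h4 := dist_triangle4 (g y) (g x) (f (φ n) x) (f (φ n) y)
  rw [dist_comm (g x), dist_comm (f (φ n) x) (f (φ n) y)] at h4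
  linarith

/-! ### The space of germs -/

variable {m : ℕ}

theorem extendZero_apply {ε : ℝ} (F : ball (0 : Cm m) ε →ᵇ Cm m) {z : Cm m}
    (hz : z ∈ ball (0 : Cm m) ε) : extendZero F z = F ⟨z, hz⟩ := by
  simp [extendZero, hz]

theorem HolGerm.IsRep.eventuallyEq {f : HolGerm m} {F G : Cm m → Cm m} (hF : f.IsRep F)
    (hG : f.IsRep G) : F =ᶠ[𝓝 0] G :=
  Germ.coe_eq.1 (hF.trans hG.symm)

theorem HolGerm.IsRep.eq {f g : HolGerm m} {F G : Cm m → Cm m} (hF : f.IsRep F)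
    (hG : g.IsRep G) (h : F =ᶠ[𝓝 0] G) : f = g :=
  Subtype.ext (hF.symm.trans ((Germ.coe_eq.2 h).trans hG))

theorem HolGerm.IsRep.map_zero {f : HolGerm m} {F : Cm m → Cm m} (hF : f.IsRep F) : F 0 = 0 := by
  obtain ⟨G, -, hG0, hG⟩ := f.2
  rw [(hF.eventuallyEq hG).eq_of_nhds, hG0]

theorem HolGerm.exists_isRep (f : HolGerm m) : ∃ F, AnalyticAt ℂ F 0 ∧ f.IsRep F := by
  obtain ⟨G, hG, -, hG'⟩ := f.2
  exact ⟨G, hG, hG'⟩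

/-- The identity principle for representatives on a ball around the origin. -/
theorem HolGerm.IsRep.eqOn_ball {f : HolGerm m} {F G : Cm m → Cm m} {ρ : ℝ} (hF : f.IsRep F)
    (hG : f.IsRep G) (hFa : AnalyticOnNhd ℂ F (ball 0 ρ)) (hGa : AnalyticOnNhd ℂ G (ball 0 ρ)) :
    EqOn F G (ball 0 ρ) := by
  rcases le_or_gt ρ 0 with h | h
  · simp [ball_eq_empty.2 h]
  · exact hFa.eqOn_of_preconnected_of_eventuallyEq hGa (convex_ball _ _).isPreconnected
      (mem_ball_self h) (hF.eventuallyEq hG)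

theorem HolGerm.IsRep.comp {f g : HolGerm m} {F G : Cm m → Cm m} (hG : g.IsRep G)
    (hF : f.IsRep F) : (g.comp f).IsRep (G ∘ F) := by
  have hF0 : Tendsto F (𝓝 0) (𝓝 0) := by
    have := f.tendsto_zero
    rwa [← show (F : Germ (𝓝 (0 : Cm m)) (Cm m)) = f.1 from hF] at this
  obtain ⟨F', hF'a, hF'0, hF'⟩ := f.2
  obtain ⟨G', hG'a, hG'0, hG'⟩ := g.2
  have hrep : (g.comp f).IsRep (G' ∘ F') := by
    obtain ⟨φ, hφ⟩ := f
    obtain ⟨ψ, hψ⟩ := g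
    subst hF' hG'
    rfl
  refine (Germ.coe_eq.2 ?_).trans hrep
  filter_upwards [hF.eventuallyEq hF', hF0.eventually (hG.eventuallyEq hG')] with z h1 h2
  simp only [Function.comp_apply]
  rw [h2, h1]

theorem BddHol.toGerm_isRep (ε : Ioi (0 : ℝ)) (F : BddHol m ε) :
    (BddHol.toGerm ε F).IsRep (extendZero F.1) := rfl

/-- The element of `X_ε` given by a bounded holomorphic map on `B_ε`. -/
theorem BddHol.exists_toGerm_eq {f : HolGerm m} {F : Cm m → Cm m} (ε : Ioi (0 : ℝ))
    (hF : AnalyticOnNhd ℂ F (ball 0 ε)) {M : ℝ} (hM : ∀ z ∈ ball (0 : Cm m) ε, ‖F z‖ ≤ M)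
    (hf : f.IsRep F) : ∃ G : BddHol m ε, BddHol.toGerm ε G = f ∧ EqOn (extendZero G.1) F (ball 0 ε)
    := by
  let G : ball (0 : Cm m) ε →ᵇ Cm m := BoundedContinuousFunction.ofNormedAddCommGroup
    (fun z => F z.1) (continuousOn_iff_continuous_domRestrict.1 hF.continuousOn) M
    (fun z => hM z.1 z.2)
  have hG : EqOn (extendZero G) F (ball 0 ε) := fun z hz => by
    rw [extendZero_apply G hz]; rfl
  have hev : extendZero G =ᶠ[𝓝 0] F := by
    filter_upwards [ball_mem_nhds _ (show (0 : ℝ) < ε from ε.2)] with z hz using hG hz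
  have hGa : AnalyticOnNhd ℂ (extendZero G) (ball 0 ε) := hF.congr isOpen_ball hG.symm
  refine ⟨⟨G, hGa, ?_⟩, ?_, hG⟩
  · rw [hev.eq_of_nhds, hf.map_zero]
  · exact (BddHol.toGerm_isRep ε _).eq hf hev

theorem BddHol.toGerm_injective (ε : Ioi (0 : ℝ)) : Function.Injective (BddHol.toGerm (m := m) ε) :=
  by
  intro F G h
  have hrep := BddHol.toGerm_isRep ε F
  rw [h] at hrep
  have heq := hrep.eqOn_ball (BddHol.toGerm_isRep ε G) F.2.1 G.2.1
  ext1
  ext1 z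
  have := heq z.2
  rwa [extendZero_apply _ z.2, extendZero_apply _ z.2] at this

theorem BddHol.continuous_toGerm (ε : Ioi (0 : ℝ)) : Continuous (BddHol.toGerm (m := m) ε) :=
  continuous_iff_coinduced_le.2
    (le_iSup (fun ε : Ioi (0 : ℝ) => TopologicalSpace.coinduced (BddHol.toGerm (m := m) ε) _) ε)

theorem HolGerm.isClosed_iff {S : Set (HolGerm m)} :
    IsClosed S ↔ ∀ ε : Ioi (0 : ℝ), IsClosed (BddHol.toGerm ε ⁻¹' S) := by
  refine isClosed_iSup_iff.trans (forall_congr' fun ε => isClosed_coinduced)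

theorem HolGerm.continuous_iff {Y : Type*} [TopologicalSpace Y] {c : HolGerm m → Y} :
    Continuous c ↔ ∀ ε : Ioi (0 : ℝ), Continuous (c ∘ BddHol.toGerm ε) := by
  refine continuous_iSup_dom.trans (forall_congr' fun ε => continuous_coinduced_dom)

/-- If a germ lies in `X_ε`, it lies in `X_δ` for `δ ≤ ε`. -/
theorem BddHol.range_toGerm_anti {δ ε : Ioi (0 : ℝ)} (h : δ ≤ ε) :
    range (BddHol.toGerm (m := m) ε) ⊆ range (BddHol.toGerm δ) := by
  rintro _ ⟨F, rfl⟩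
  have hsub : ball (0 : Cm m) δ ⊆ ball 0 ε := ball_subset_ball h
  obtain ⟨G, hG, -⟩ := BddHol.exists_toGerm_eq (f := BddHol.toGerm ε F) δ (F.2.1.mono hsub)
    (M := ‖F.1‖) (fun z hz => by
      rw [extendZero_apply _ (hsub hz)]; exact F.1.norm_coe_le_norm _) (BddHol.toGerm_isRep ε F)
  exact ⟨G, hG⟩

theorem HolGerm.exists_mem_range_toGerm (f : HolGerm m) :
    ∃ ε : Ioi (0 : ℝ), f ∈ range (BddHol.toGerm (m := m) ε) := by
  obtain ⟨F, hFa, hF⟩ := f.exists_isRep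
  obtain ⟨ρ, hρ, hρF⟩ := Metric.eventually_nhds_iff_ball.1
    (hFa.eventually_analyticAt.and (hFa.continuousAt.norm.eventually_lt_const (lt_add_one ‖F 0‖)))
  obtain ⟨G, hG, -⟩ := BddHol.exists_toGerm_eq ⟨ρ, hρ⟩ (fun z hz => (hρF z hz).1)
    (fun z hz => (hρF z hz).2.le) hF
  exact ⟨_, G, hG⟩

/-- The radii `1 / (n + 1)`. -/
noncomputable def invRadius (n : ℕ) : Ioi (0 : ℝ) :=
  ⟨1 / ((n : ℝ) + 1), mem_Ioi.2 Nat.one_div_pos_of_nat⟩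

theorem exists_invRadius_le (ε : Ioi (0 : ℝ)) : ∃ N, ∀ n ≥ N, invRadius n ≤ ε := by
  obtain ⟨N, hN⟩ := exists_nat_one_div_lt (show (0 : ℝ) < ε from ε.2)
  exact ⟨N, fun n hn =>
    show 1 / ((n : ℝ) + 1) ≤ ε from (Nat.one_div_le_one_div hn).trans hN.le⟩

/-- All germs in a compact set are bounded and holomorphic on a common ball. -/
theorem HolGerm.exists_subset_range_of_isCompact {K : Set (HolGerm m)} (hK : IsCompact K) :
    ∃ ε : Ioi (0 : ℝ), K ⊆ range (BddHol.toGerm (m := m) ε) := by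
  by_contra! hcon
  simp only [not_subset] at hcon
  choose f hfK hf using fun n => hcon (invRadius n)
  have hfin : ∀ ε : Ioi (0 : ℝ), ∀ S ⊆ range f, (BddHol.toGerm ε ⁻¹' S).Finite := by
    intro ε S hS
    obtain ⟨N, hN⟩ := exists_invRadius_le ε
    refine Finite.subset (((finite_Iio N).image f).preimage (BddHol.toGerm_injective ε).injOn) ?_
    intro F hF
    obtain ⟨n, hn⟩ := hS hF
    refine ⟨n, ?_, hn⟩
    by_contra h
    exact hf n (hn ▸ BddHol.range_toGerm_anti (hN n (not_lt.1 h)) ⟨F, rfl⟩)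
  -- Each `X_ε` contains only finitely many of the bad germs, so every subset of `range f` is
  -- closed. An infinite such set has no accumulation point, which is impossible inside a compact
  -- set.
  have hclosed : ∀ S ⊆ range f, IsClosed S := fun S hS =>
    HolGerm.isClosed_iff.2 fun ε => (hfin ε S hS).isClosed
  have hinf : (range f).Infinite := by
    intro hfi
    -- If the range were finite, its germs would all lie in one `X_ε` with `ε = 1 / (B + 1)`,
    -- contradicting the choice of `f B`.
    choose ε hε using fun g : HolGerm m => g.exists_mem_range_toGerm
    choose N hN using fun g : HolGerm m => exists_invRadius_le (ε g)
    obtain ⟨B, hB⟩ := (hfi.image N).bddAbove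
    exact hf B (BddHol.range_toGerm_anti (hN (f B) B (hB ⟨f B, ⟨B, rfl⟩, rfl⟩)) (hε _))
  obtain ⟨x, -, hx⟩ := hinf.exists_accPt_of_subset_isCompact hK (range_subset_iff.2 hfK)
  rw [accPt_iff_nhds] at hx
  obtain ⟨y, ⟨hy1, hy2⟩, hy3⟩ := hx (range f \ {x})ᶜ
    ((hclosed _ sdiff_subset).isOpen_compl.mem_nhds (by simp))
  exact hy1 ⟨hy2, hy3⟩

/-- The maps in `X_ε` that extend continuously to the closed ball. -/
def BddHol.extendable (m : ℕ) (ε : ℝ) : Set (BddHol m ε) :=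
  {G | ∃ h : C(closedBall (0 : Cm m) ε, Cm m),
    ∀ z : ball (0 : Cm m) ε, h ⟨z, ball_subset_closedBall z.2⟩ = G.1 z}

/-- These maps are restrictions of continuous maps on a compact ball, which form a separable space.
-/
theorem BddHol.isSeparable_extendable (m : ℕ) (ε : ℝ) :
    TopologicalSpace.IsSeparable (BddHol.extendable m ε) := by
  let ι : C(ball (0 : Cm m) ε, closedBall (0 : Cm m) ε) :=
    ⟨fun z => ⟨z, ball_subset_closedBall z.2⟩, by fun_prop⟩
  let res : C(closedBall (0 : Cm m) ε, Cm m) → (ball (0 : Cm m) ε →ᵇ Cm m) := fun h =>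
    (ContinuousMap.isometryEquivBoundedOfCompact _ _ h).compContinuous ι
  have hres : Continuous res := (BoundedContinuousFunction.continuous_compContinuous ι).comp
    (ContinuousMap.isometryEquivBoundedOfCompact _ _).continuous
  refine ((TopologicalSpace.isSeparable_range hres).mono ?_ : TopologicalSpace.IsSeparable
    (Subtype.val '' BddHol.extendable m ε)) |> fun h =>
      (IsEmbedding.subtypeVal.isSeparable_preimage h).mono (subset_preimage_image _ _)
  rintro _ ⟨G, ⟨h, hh⟩, rfl⟩
  exact ⟨h, BoundedContinuousFunction.ext hh⟩

theorem _root_.TopologicalSpace.IsSeparable.isLindelof {X : Type*} [PseudoMetricSpace X] {s : Set X}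
    (hs : TopologicalSpace.IsSeparable s) : IsLindelof s := by
  have := hs.separableSpace
  have := UniformSpace.secondCountable_of_separable s
  simpa using (HereditarilyLindelofSpace.isLindelof (univ : Set s)).image continuous_subtype_val

/-- This is what makes the complement of the support null. Shrinking the radius makes any germ
extend continuously to a closed ball, so an open set is a countable union of continuous images of
separable metric pieces. -/
instance : HereditarilyLindelofSpace (HolGerm m) := by
  refine HereditarilyLindelofSpace.of_forall_isOpen fun W _ => ?_
  have hW : W = ⋃ n, BddHol.toGerm (invRadius n) ''
      (BddHol.toGerm (invRadius n) ⁻¹' W ∩ BddHol.extendable m (invRadius n)) := by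
    refine Subset.antisymm (fun f hf => ?_) (iUnion_subset fun n => ?_)
    · obtain ⟨ε, F, hF⟩ := f.exists_mem_range_toGerm
      obtain ⟨N, hN⟩ := exists_invRadius_le ⟨ε / 2, half_pos (show (0 : ℝ) < ε from ε.2)⟩
      have hlt : (invRadius N : ℝ) < ε := lt_of_le_of_lt (hN N le_rfl)
        (half_lt_self (show (0 : ℝ) < ε from ε.2))
      have hsub : closedBall (0 : Cm m) (invRadius N) ⊆ ball 0 ε := closedBall_subset_ball hlt
      have hsub' := ball_subset_closedBall.trans hsub
      obtain ⟨G, hG, hGF⟩ := BddHol.exists_toGerm_eq (f := f) (invRadius N) (F.2.1.mono hsub')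
        (M := ‖F.1‖) (fun z hz => by
          rw [extendZero_apply _ (hsub' hz)]; exact F.1.norm_coe_le_norm _)
        (hF ▸ BddHol.toGerm_isRep ε F)
      refine mem_iUnion.2 ⟨N, G, ⟨by rwa [mem_preimage, hG], ?_⟩, hG⟩
      refine ⟨⟨_, (F.2.1.continuousOn.mono hsub).domRestrict⟩, fun z => ?_⟩
      rw [← extendZero_apply G.1 z.2, hGF z.2]
      rfl
    · rintro _ ⟨G, ⟨hG, -⟩, rfl⟩
      exact hG
  rw [hW]
  exact isLindelof_iUnion fun n =>
    ((BddHol.isSeparable_extendable m _).mono inter_subset_right).isLindelof.image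
      (BddHol.continuous_toGerm _)

/-! ### Measurable dependence on the germ -/

/-- The `n`-th derivative at the origin of the germ along the complex line through `z`. -/
noncomputable def HolGerm.lineDeriv (n : ℕ) (z : Cm m) (f : HolGerm m) : Cm m :=
  iteratedDeriv n (fun t : ℂ => f.exists_isRep.choose (t • z)) 0

theorem HolGerm.IsRep.lineDeriv_eq {f : HolGerm m} {F : Cm m → Cm m} (hF : f.IsRep F) (n : ℕ)
    (z : Cm m) : f.lineDeriv n z = iteratedDeriv n (fun t : ℂ => F (t • z)) 0 := by
  refine Filter.EventuallyEq.iteratedDeriv_eq n ?_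
  have h : Tendsto (fun t : ℂ => t • z) (𝓝 0) (𝓝 0) := by
    have : Continuous fun t : ℂ => t • z := by fun_prop
    simpa using this.tendsto 0
  exact h.eventually (f.exists_isRep.choose_spec.2.eventuallyEq hF)

theorem smul_mem_ball {z : Cm m} {R ρ : ℝ} (h : ρ * ‖z‖ < R) {t : ℂ} (ht : ‖t‖ ≤ ρ) :
    t • z ∈ ball (0 : Cm m) R := by
  rw [mem_ball_zero_iff, norm_smul]
  exact (mul_le_mul_of_nonneg_right ht (norm_nonneg z)).trans_lt h

theorem differentiableOn_comp_smul {F : Cm m → Cm m} {R ρ : ℝ}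
    (hF : AnalyticOnNhd ℂ F (ball 0 R)) {z : Cm m} (h : ρ * ‖z‖ < R) :
    DifferentiableOn ℂ (fun t : ℂ => F (t • z)) (closedBall 0 ρ) :=
  hF.differentiableOn.comp (by fun_prop) fun t ht => smul_mem_ball h (by simpa using ht)

/-- Cauchy's estimate on a disc of radius `s` makes this functional Lipschitz on each `X_ε`, which
suffices for the inductive limit topology. -/
theorem HolGerm.continuous_lineDeriv (n : ℕ) (z : Cm m) :
    Continuous (HolGerm.lineDeriv (m := m) n z) := by
  refine HolGerm.continuous_iff.2 fun ε => ?_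
  have hε : (0 : ℝ) < ε := ε.2
  set s : ℝ := ε / (‖z‖ + 1) with hs
  have hs0 : 0 < s := by positivity
  have hsz : s * ‖z‖ < ε := by
    rw [hs, div_mul_eq_mul_div, div_lt_iff₀ (by positivity)]
    nlinarith [norm_nonneg z]
  refine (LipschitzWith.of_dist_le' (K := n.factorial / s ^ n) fun F G => ?_).continuous
  simp only [Function.comp_apply]
  rw [(BddHol.toGerm_isRep ε F).lineDeriv_eq, (BddHol.toGerm_isRep ε G).lineDeriv_eq]
  have hd : ∀ F : BddHol m ε, DifferentiableOn ℂ (fun t : ℂ => extendZero F.1 (t • z))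
    (closedBall 0 s) := fun F => differentiableOn_comp_smul F.2.1 hsz
  have hc : ∀ F : BddHol m ε, ContDiffAt ℂ n (fun t : ℂ => extendZero F.1 (t • z)) 0 := fun F =>
    ((hd F).analyticAt (closedBall_mem_nhds _ hs0)).contDiffAt
  rw [dist_eq_norm, ← iteratedDeriv_sub (hc F) (hc G), div_mul_eq_mul_div]
  refine Complex.norm_iteratedDeriv_le_of_forall_mem_sphere_norm_le n hs0 ?_ fun t ht => ?_
  · exact (((hd F).sub (hd G)).mono closure_ball_subset_closedBall).diffContOnCl
  · have htb : t • z ∈ ball (0 : Cm m) ε := smul_mem_ball hsz (by simpa using ht.le)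
    rw [Pi.sub_apply, extendZero_apply _ htb, extendZero_apply _ htb, ← dist_eq_norm]
    exact BoundedContinuousFunction.dist_coe_le_dist _

theorem HolGerm.IsRep.hasSum_lineDeriv {f : HolGerm m} {F : Cm m → Cm m} (hf : f.IsRep F) {R : ℝ}
    (hF : AnalyticOnNhd ℂ F (ball 0 R)) {z : Cm m} (hz : z ∈ ball (0 : Cm m) R) :
    HasSum (fun n : ℕ => ((n.factorial : ℂ))⁻¹ • f.lineDeriv n z) (F z) := by
  have hzR : ‖z‖ < R := by simpa using hz
  have hR : 0 < R := (norm_nonneg z).trans_lt hzR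
  -- A radius `ρ > 1` with `ρ * ‖z‖ < R`, so that the Taylor series along the line through `z`
  -- converges at `t = 1`.
  set ρ : ℝ := 2 * R / (R + ‖z‖)
  have h1 : 1 < ρ := by
    rw [one_lt_div (by positivity)]
    linarith
  have h2 : ρ * ‖z‖ < R := by
    rw [div_mul_eq_mul_div, div_lt_iff₀ (by positivity)]
    nlinarith [norm_nonneg z]
  have h := Complex.hasSum_taylorSeries_on_ball
    ((differentiableOn_comp_smul hF h2).mono ball_subset_closedBall)
    (show (1 : ℂ) ∈ ball (0 : ℂ) ρ by simpa using h1)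
  simpa [hf.lineDeriv_eq] using h

theorem HolGerm.onBall_spec {R : ℝ} {f : HolGerm m}
    (h : ∃ F : Cm m → Cm m, AnalyticOnNhd ℂ F (ball 0 R) ∧ f.IsRep F) :
    AnalyticOnNhd ℂ (f.onBall R) (ball 0 R) ∧ f.IsRep (f.onBall R) := by
  rw [HolGerm.onBall, dif_pos h]
  exact h.choose_spec

/-- All germs in `K` are holomorphic on `B_R`. -/
def HolomorphicOnBall (K : Set (HolGerm m)) (R : ℝ) : Prop :=
  ∀ f ∈ K, ∃ F : Cm m → Cm m, AnalyticOnNhd ℂ F (ball 0 R) ∧ f.IsRep F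

/-- The evaluation of germs in `K` at points of `B_R`, extended by zero. -/
noncomputable def evalOn (K : Set (HolGerm m)) (R : ℝ) (p : HolGerm m × Cm m) : Cm m :=
  open Classical in if p ∈ K ×ˢ ball (0 : Cm m) R then p.1.onBall R p.2 else 0

/-- The value at `z` is the pointwise limit of Taylor partial sums, which are continuous in the
germ. -/
theorem measurable_onBall {K : Set (HolGerm m)} {R : ℝ} (hK : HolomorphicOnBall K R)
    {z : Cm m} (hz : z ∈ ball (0 : Cm m) R) : Measurable fun f : K => f.1.onBall R z := by
  refine measurable_of_tendsto_metrizable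
    (f := fun N (f : K) => ∑ n ∈ Finset.range N, ((n.factorial : ℂ))⁻¹ • f.1.lineDeriv n z)
    (fun N => ?_) (tendsto_pi_nhds.2 fun f => ?_)
  · refine Finset.measurable_sum _ fun n _ => ?_
    exact ((HolGerm.continuous_lineDeriv n z).const_smul ((n.factorial : ℂ))⁻¹).measurable.comp
      measurable_subtype_coe
  · obtain ⟨h1, h2⟩ := HolGerm.onBall_spec (hK f.1 f.2)
    exact (h2.hasSum_lineDeriv h1 hz).tendsto_sum_nat

/-- A Carathéodory function: continuous in the point and measurable in the germ, hence jointly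
measurable. -/
theorem measurable_evalOn {K : Set (HolGerm m)} (hKm : MeasurableSet K) {R : ℝ}
    (hK : HolomorphicOnBall K R) : Measurable (evalOn K R) := by
  classical
  have h : Measurable (Function.uncurry fun (z : ball (0 : Cm m) R) (f : K) =>
      f.1.onBall R z.1) :=
    measurable_uncurry_of_continuous_of_measurable
      (fun f => (HolGerm.onBall_spec (hK f.1 f.2)).1.continuousOn.domRestrict)
      (fun z => measurable_onBall hK z.2)
  have h' : Measurable fun p : (K ×ˢ ball (0 : Cm m) R : Set (HolGerm m × Cm m)) =>
      p.1.1.onBall R p.1.2 := by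
    refine h.comp (g := Function.uncurry _) (f := fun p : (K ×ˢ ball (0 : Cm m) R :
      Set (HolGerm m × Cm m)) => ((⟨p.1.2, p.2.2⟩ : ball (0 : Cm m) R), (⟨p.1.1, p.2.1⟩ : K))) ?_
    exact (measurable_subtype_coe.snd.subtype_mk).prodMk (measurable_subtype_coe.fst.subtype_mk)
  exact Measurable.dite h' (measurable_const (a := (0 : Cm m))) (hKm.prod measurableSet_ball)

/-! ### Recurrence of the shift -/

/-- The shift on sequences. -/
def shift {X : Type*} (n : ℕ) (ω : ℕ → X) : ℕ → X := fun k => ω (n + k)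

theorem shift_one_iterate {X : Type*} (n : ℕ) (ω : ℕ → X) : (shift 1)^[n] ω = shift n ω := by
  induction n generalizing ω with
  | zero => funext k; simp [shift]
  | succ n ih =>
    rw [Function.iterate_succ_apply, ih]
    funext k
    simp only [shift]
    congr 1
    omega

theorem shift_shift {X : Type*} (n k : ℕ) (ω : ℕ → X) : shift n (shift k ω) = shift (n + k) ω := by
  funext j
  simp only [shift]
  congr 1
  omega

variable {X : Type*} [MeasurableSpace X]

theorem measurable_shift (n : ℕ) : Measurable (shift (X := X) n) :=
  measurable_pi_iff.2 fun k => measurable_pi_apply (n + k)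

theorem measurePreserving_shift_one (ν : Measure X) [IsProbabilityMeasure ν] :
    MeasurePreserving (shift 1) (Measure.infinitePi fun _ : ℕ => ν)
      (Measure.infinitePi fun _ : ℕ => ν) := by
  refine ⟨measurable_shift 1, Measure.eq_infinitePi _ fun s t ht => ?_⟩
  rw [Measure.map_apply (measurable_shift 1)
    (MeasurableSet.pi s.countable_toSet fun i _ => ht i)]
  have h : shift 1 ⁻¹' Set.pi s t =
      Set.pi (s.map (addLeftEmbedding 1)) (fun i => t (i - 1)) := by
    ext ω
    simp [shift, Set.mem_pi]
  rw [h, Measure.infinitePi_pi _ (fun i _ => ht _)]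
  simp

/-- Almost every orbit of the Bernoulli shift visits a set of positive measure infinitely often. -/
theorem ae_frequently_shift_mem (ν : Measure X) [IsProbabilityMeasure ν] {A : Set (ℕ → X)}
    (hA : MeasurableSet A) (h0 : Measure.infinitePi (fun _ : ℕ => ν) A ≠ 0) :
    ∀ᵐ ω ∂(Measure.infinitePi fun _ : ℕ => ν), ∃ᶠ n in atTop, shift n ω ∈ A := by
  set μ := Measure.infinitePi fun _ : ℕ => ν with hμ
  set E : Set (ℕ → X) := {ω | ∃ᶠ n in atTop, shift n ω ∈ A} with hE
  -- Poincaré recurrence only concerns points of `A`; it shows that `E` has positive measure.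
  have hrec : ∀ᵐ ω ∂μ, ω ∈ A → ω ∈ E := by
    have := (measurePreserving_shift_one ν).conservative.ae_mem_imp_frequently_image_mem
      hA.nullMeasurableSet
    simp only [shift_one_iterate] at this
    exact this
  have hEm : MeasurableSet E := by
    have : E = ⋂ N : ℕ, ⋃ n : ℕ, ⋃ _ : N ≤ n, shift n ⁻¹' A := by
      ext ω
      simp [hE, frequently_atTop]
    rw [this]
    exact .iInter fun N => .iUnion fun n => .iUnion fun _ => measurable_shift n hA
  have hE0 : μ E ≠ 0 := fun h => h0 (measure_mono_null_ae hrec h)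
  have hinv : ∀ N, shift N ⁻¹' E = E := by
    intro N
    ext ω
    simp only [hE, mem_preimage, mem_ofPred_eq, shift_shift]
    conv_rhs => rw [← map_add_atTop_eq_nat N, frequently_map]
  have hind : ProbabilityTheory.iIndep
      (fun n : ℕ => MeasurableSpace.comap (fun ω : ℕ → X => ω n) inferInstance) μ :=
    ProbabilityTheory.iIndepFun_infinitePi (P := fun _ : ℕ => ν) (X := fun _ x => x)
      (fun _ => measurable_id)
  have htail : MeasurableSet[limsup (fun n : ℕ =>
      MeasurableSpace.comap (fun ω : ℕ → X => ω n) inferInstance) atTop] E := by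
    rw [limsup_eq_iInf_iSup_of_nat]
    refine MeasurableSpace.measurableSet_iInf.2 fun N => ?_
    -- By shift invariance `E` depends only on the coordinates from `N` on, for every `N`; it is a
    -- tail event, to which the zero-one law applies.
    rw [← hinv N]
    have hm : @Measurable _ _ (⨆ i, ⨆ (_ : i ≥ N),
        MeasurableSpace.comap (fun ω : ℕ → X => ω i) inferInstance) _ (shift (X := X) N) := by
      refine @measurable_pi_iff _ _ _ (_) _ _ |>.2 fun k => ?_
      refine Measurable.mono (comap_measurable fun ω : ℕ → X => ω (N + k)) ?_ le_rfl
      exact le_iSup₂_of_le (N + k) (Nat.le_add_right N k) le_rfl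
    exact hm hEm
  have h1 := (ProbabilityTheory.measure_zero_or_one_of_measurableSet_limsup_atTop
    (fun n => (measurable_pi_apply n).comap_le) hind htail).resolve_left hE0
  exact (prob_compl_eq_zero_iff hEm).2 h1

/-! ### Orbits -/

variable {K : Set (HolGerm m)} {R : ℝ} {ω : ℕ → HolGerm m}

theorem orbit_add (R : ℝ) (ω : ℕ → HolGerm m) (n k : ℕ) (z : Cm m) :
    orbit R ω (n + k) z = orbit R (shift n ω) k (orbit R ω n z) := by
  induction k with
  | zero => rfl
  | succ k ih => rw [← add_assoc, orbit, ih]; rfl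

theorem analyticOnNhd_orbit (hK : HolomorphicOnBall K R) (hω : ∀ n, ω n ∈ K) {U : Set (Cm m)}
    {n : ℕ} (hU : ∀ k < n, MapsTo (orbit R ω k) U (ball 0 R)) :
    AnalyticOnNhd ℂ (orbit R ω n) U := by
  induction n with
  | zero => exact analyticOnNhd_id
  | succ n ih =>
    exact (HolGerm.onBall_spec (hK _ (hω n))).1.comp (ih fun k hk => hU k (hk.trans n.lt_succ_self))
      (hU n n.lt_succ_self)

/-- No condition on domains is needed, since every map fixes the origin and only the germ there
matters. -/
theorem isRep_orbit (hK : HolomorphicOnBall K R) (hω : ∀ n, ω n ∈ K) (n : ℕ) :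
    (iterGerm ω n).IsRep (orbit R ω n) := by
  induction n with
  | zero => rfl
  | succ n ih => exact (HolGerm.onBall_spec (hK _ (hω n))).2.comp ih

/-- The sequences in `K` all of whose iterates map `B_r` into the closed ball of radius `R / 2`. -/
def stableSeq (K : Set (HolGerm m)) (R r : ℝ) : Set (ℕ → HolGerm m) :=
  {ω | (∀ n, ω n ∈ K) ∧ ∀ n, ∀ z ∈ ball (0 : Cm m) r, ‖orbit R ω n z‖ ≤ R / 2}

/-- The orbits computed with `evalOn`. -/
noncomputable def cutOrbit (K : Set (HolGerm m)) (R : ℝ) : ℕ → Cm m → (ℕ → HolGerm m) → Cm m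
  | 0, z, _ => z
  | n + 1, z, ω => evalOn K R (ω n, cutOrbit K R n z ω)

theorem measurable_cutOrbit (hKm : MeasurableSet K) (hK : HolomorphicOnBall K R) (n : ℕ)
    (z : Cm m) : Measurable (cutOrbit K R n z) := by
  induction n with
  | zero => exact measurable_const
  | succ n ih => exact (measurable_evalOn hKm hK).comp ((measurable_pi_apply n).prodMk ih)

theorem cutOrbit_succ_eq (hω : ∀ n, ω n ∈ K) {z : Cm m} {n : ℕ}
    (h : cutOrbit K R n z ω = orbit R ω n z) (hn : orbit R ω n z ∈ ball (0 : Cm m) R) :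
    cutOrbit K R (n + 1) z ω = orbit R ω (n + 1) z := by
  rw [cutOrbit, h, evalOn, if_pos ⟨hω n, hn⟩, orbit]

/-- By continuity the closed bound needs testing only on a countable dense set. There `orbit` may be
replaced by the measurable `cutOrbit`, as the two agree while the orbit stays in `B_R`. -/
theorem measurableSet_stableSeq (hKm : MeasurableSet K) (hK : HolomorphicOnBall K R) (hR : 0 < R)
    (r : ℝ) : MeasurableSet (stableSeq K R r) := by
  obtain ⟨D, hDc, hDd⟩ := TopologicalSpace.exists_countable_dense (Cm m)
  have hmem : ∀ {x : Cm m}, ‖x‖ ≤ R / 2 → x ∈ ball (0 : Cm m) R := fun {x} hx => by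
    rw [mem_ball_zero_iff]; linarith
  have heq : stableSeq K R r = (⋂ n, (fun ω => ω n) ⁻¹' K) ∩
      ⋂ n, ⋂ z ∈ D ∩ ball (0 : Cm m) r, {ω | ‖cutOrbit K R n z ω‖ ≤ R / 2} := by
    ext ω
    simp only [stableSeq, mem_inter_iff, mem_iInter, mem_preimage, mem_ofPred_eq]
    refine and_congr_right fun hω => ⟨fun h n z hz => ?_, fun h => ?_⟩
    · have : cutOrbit K R n z ω = orbit R ω n z := by
        induction n with
        | zero => rfl
        | succ n ih => exact cutOrbit_succ_eq hω ih (hmem (h n z hz.2))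
      rw [this]
      exact h n z hz.2
    · have hD : ∀ n, ∀ z ∈ D ∩ ball (0 : Cm m) r, cutOrbit K R n z ω = orbit R ω n z := by
        intro n z hz
        induction n with
        | zero => rfl
        | succ n ih => exact cutOrbit_succ_eq hω ih (hmem (ih ▸ h n z hz))
      intro n
      induction n using Nat.strong_induction_on with
      | _ n ih =>
        have han : ContinuousOn (orbit R ω n) (ball 0 r) :=
          (analyticOnNhd_orbit hK hω fun k hk z hz => hmem (ih k hk z hz)).continuousOn
        intro z hz
        have hzc : z ∈ closure (ball (0 : Cm m) r ∩ D) :=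
          hDd.open_subset_closure_inter isOpen_ball hz
        have := (han z hz).mono (inter_subset_left (t := D)) |>.mem_closure hzc
          (t := closedBall 0 (R / 2)) fun w hw => by
            rw [mem_closedBall_zero_iff, ← hD n w hw.symm]
            exact h n w hw.symm
        rwa [isClosed_closedBall.closure_eq, mem_closedBall_zero_iff] at this
  rw [heq]
  refine (MeasurableSet.iInter fun n => measurable_pi_apply n hKm).inter
    (MeasurableSet.iInter fun n => MeasurableSet.biInter (hDc.mono inter_subset_left) fun z _ => ?_)
  exact measurableSet_le (measurable_cutOrbit hKm hK n z).norm measurable_const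

theorem stableSeq_anti {r s : ℝ} (h : r ≤ s) : stableSeq K R s ⊆ stableSeq K R r :=
  fun _ hω => ⟨hω.1, fun n z hz => hω.2 n z (ball_subset_ball h hz)⟩

/-- Normality near the origin makes the iterates map some small ball into `B_{R/2}`. -/
theorem exists_mem_stableSeq (hK : HolomorphicOnBall K R) (hR : 0 < R) (hω : ∀ n, ω n ∈ K)
    (hn : IsNormalNearZero ω) : ∃ r > 0, ω ∈ stableSeq K R r := by
  obtain ⟨ρ, hρ, F, hF, hnorm⟩ := hn
  -- Otherwise there are points `z j` tending to `0` whose images under `F (s j)` have norm above `R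
  -- / 2`; along a locally uniformly convergent subsequence these images tend to `G 0 = 0`.
  have hsmall : ∃ r ∈ Ioc 0 ρ, ∀ n, ∀ z ∈ ball (0 : Cm m) r, ‖F n z‖ ≤ R / 2 := by
    by_contra! hcon
    have hr : ∀ j : ℕ, ρ * (1 / ((j : ℝ) + 1)) ∈ Ioc 0 ρ := fun j => by
      refine ⟨by positivity, mul_le_of_le_one_right hρ.le ?_⟩
      rw [div_le_one (by positivity)]
      linarith [j.cast_nonneg (α := ℝ)]
    choose s z hz hs using fun j => hcon _ (hr j)
    obtain ⟨φ, hφ, G, hG⟩ := hnorm s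
    have h0 : (0 : Cm m) ∈ ball (0 : Cm m) ρ := mem_ball_self hρ
    have hG0 : G 0 = 0 := by
      refine tendsto_nhds_unique (hG.tendsto_at h0) ?_
      simp only [(hF _).2.map_zero]
      exact tendsto_const_nhds
    have hGc : ContinuousOn G (ball 0 ρ) :=
      hG.continuousOn (Frequently.of_forall fun k => (hF _).1.continuousOn)
    have hz0 : Tendsto z atTop (𝓝 0) := by
      refine squeeze_zero_norm (fun j => (mem_ball_zero_iff.1 (hz j)).le) ?_
      simpa using tendsto_one_div_add_atTop_nhds_zero_nat.const_mul ρ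
    have hlim : Tendsto (fun k => F (s (φ k)) (z (φ k))) atTop (𝓝 (G 0)) := by
      refine hG.tendsto_comp (hGc 0 h0) h0 ?_
      refine tendsto_nhdsWithin_iff.2 ⟨hz0.comp hφ.tendsto_atTop, .of_forall fun k => ?_⟩
      exact ball_subset_ball (hr _).2 (hz _)
    rw [hG0] at hlim
    have := hlim.norm.eventually_lt_const (show ‖(0 : Cm m)‖ < R / 2 by simpa using hR)
    obtain ⟨k, hk⟩ := this.exists
    exact hk.not_gt (hs (φ k))
  obtain ⟨r, hr, hrF⟩ := hsmall
  -- The bound on earlier iterates keeps orbits in `B_R`, so `orbit R ω n` is holomorphic on the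
  -- small ball and the identity principle applies.
  have heq : ∀ n, EqOn (orbit R ω n) (F n) (ball 0 r) := by
    intro n
    induction n using Nat.strong_induction_on with
    | _ n ih =>
      refine (isRep_orbit hK hω n).eqOn_ball (hF n).2 (analyticOnNhd_orbit hK hω ?_)
        ((hF n).1.mono (ball_subset_ball hr.2))
      intro k hk z hz
      rw [ih k hk hz, mem_ball_zero_iff]
      linarith [hrF k z hz]
  exact ⟨r, hr.1, hω, fun n z hz => heq n hz ▸ hrF n z hz⟩

/-- Points near the origin with close positions have uniformly close orbits. -/
theorem norm_orbit_sub_le (hK : HolomorphicOnBall K R) (hR : 0 < R) {r : ℝ}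
    (hω : ω ∈ stableSeq K R (3 * r)) {x y : Cm m} (hx : ‖x‖ < 2 * r) (hy : y ∈ ball x r) (n : ℕ) :
    ‖orbit R ω n y - orbit R ω n x‖ ≤ R / r * ‖y - x‖ := by
  -- The factor `3` leaves room for a ball of radius `r` about any point of norm below `2 * r`; the
  -- bound `R / 2` on it gives the Lipschitz constant `R / r`.
  have hsub : ball x r ⊆ ball 0 (3 * r) := by
    refine ball_subset_ball' ?_
    rw [dist_zero_right]
    linarith
  have han : AnalyticOnNhd ℂ (orbit R ω n) (ball 0 (3 * r)) :=
    analyticOnNhd_orbit hK hω.1 fun k _ z hz => by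
      rw [mem_ball_zero_iff]
      linarith [hω.2 k z hz]
  have := norm_sub_le_of_bounded_on_ball (han.differentiableOn.mono hsub)
    (fun w hw => hω.2 n w (hsub hw)) hy
  rwa [mul_div_cancel₀ R two_ne_zero] at this

/-! ### The stable sets -/

theorem isOpen_fatouComponent (R : ℝ) (ω : ℕ → HolGerm m) : IsOpen (fatouComponent R ω) :=
  isOpen_interior.connectedComponentIn

theorem orbit_mem_of_mem_fatouComponent {z : Cm m} (hz : z ∈ fatouComponent R ω) (n : ℕ) :
    orbit R ω n z ∈ ball (0 : Cm m) R :=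
  interior_subset (connectedComponentIn_subset _ _ hz) n

theorem zero_mem_fatouComponent (hR : 0 < R) {r : ℝ} (hr : 0 < r) (hω : ω ∈ stableSeq K R r) :
    (0 : Cm m) ∈ fatouComponent R ω := by
  refine mem_connectedComponentIn (mem_interior.2 ⟨ball 0 r, ?_, isOpen_ball, mem_ball_self hr⟩)
  intro z hz n
  rw [mem_ball_zero_iff]
  linarith [hω.2 n z hz]

/-- If `ω` returns infinitely often to the stable sequences, the stable sets near the zero set of a
suitable limit map are its fibres. -/
theorem exists_limit_stableSet_eq (hK : HolomorphicOnBall K R) (hR : 0 < R) (hω : ∀ n, ω n ∈ K)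
    {r : ℝ} (hr : 0 < r) (hret : ∃ᶠ n in atTop, shift n ω ∈ stableSeq K R (3 * r)) :
    ∃ n : ℕ → ℕ, StrictMono n ∧ ∃ g : Cm m → Cm m,
      TendstoLocallyUniformlyOn (fun k => orbit R ω (n k)) g atTop (fatouComponent R ω) ∧
      ∀ z ∈ fatouComponent R ω, ‖g z‖ ≤ r →
        stableSet R ω z = {w ∈ fatouComponent R ω | g w = g z} := by
  obtain ⟨t, ht, htA⟩ := extraction_of_frequently_atTop hret
  have hdiff : ∀ n, DifferentiableOn ℂ (orbit R ω (t n)) (fatouComponent R ω) := fun n =>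
    (analyticOnNhd_orbit hK hω fun k _ z hz =>
      orbit_mem_of_mem_fatouComponent hz k).differentiableOn
  obtain ⟨φ, hφ, g, hg⟩ := exists_subseq_tendstoLocallyUniformlyOn (isOpen_fatouComponent R ω)
    hdiff (M := R) fun n z hz => (mem_ball_zero_iff.1 (orbit_mem_of_mem_fatouComponent hz _)).le
  have hn : StrictMono fun k => t (φ k) := ht.comp hφ
  refine ⟨fun k => t (φ k), hn, g, hg, fun z hz hgz => ?_⟩
  have hgz' := hg.tendsto_at hz
  ext w
  refine and_congr_right fun hw => ?_
  have hgw' := hg.tendsto_at hw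
  constructor
  · intro h
    have h1 := (hgz'.sub hgw').norm
    have h2 := h.comp hn.tendsto_atTop
    exact (sub_eq_zero.1 (norm_eq_zero.1 (tendsto_nhds_unique h1 h2))).symm
  · intro h
    have hzero : Tendsto (fun k => ‖orbit R ω (t (φ k)) z - orbit R ω (t (φ k)) w‖) atTop (𝓝 0) :=
      by simpa [h] using (hgz'.sub hgw').norm
    refine Metric.tendsto_atTop.2 fun ε hε => ?_
    -- The gap between `r` and `2 * r` lets the orbit of `w` at a late return time satisfy the
    -- strict bound that the Lipschitz estimate requires.
    have hbound : ‖g z‖ < 2 * r := by linarith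
    have hδ : 0 < min r (ε * r / R) := by positivity
    obtain ⟨k, hk1, hk2⟩ := ((hgw'.norm.eventually_lt_const (h.symm ▸ hbound)).and
      (hzero.eventually_lt_const hδ)).exists
    refine ⟨t (φ k), fun n hnk => ?_⟩
    obtain ⟨j, rfl⟩ := Nat.exists_eq_add_of_le hnk
    have hle := norm_orbit_sub_le hK hR (htA (φ k)) hk1
      (mem_ball_iff_norm.2 (hk2.trans_le (min_le_left _ _))) j
    rw [← orbit_add, ← orbit_add] at hle
    rw [dist_zero_right, norm_norm]
    calc _ ≤ R / r * ‖orbit R ω (t (φ k)) z - orbit R ω (t (φ k)) w‖ := hle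
      _ < R / r * (ε * r / R) := by
        gcongr
        exact hk2.trans_le (min_le_right _ _)
      _ = ε := by field_simp

end RandomGerms

/-! ### The main theorem -/

theorem mainTheorem8 (m : ℕ) (ν : Measure (RandomGerms.HolGerm m)) [IsProbabilityMeasure ν]
    (hcompact : IsCompact ν.support) (hfatou : RandomGerms.OriginInRandomFatouSet ν) :
    (∃ R > 0, RandomGerms.BoundedOnBall ν R) ∧
    ∀ R > 0, RandomGerms.BoundedOnBall ν R →
      ∃ r > 0, ∀ᵐ ω ∂(RandomGerms.seqLaw ν),
        (0 : RandomGerms.Cm m) ∈ RandomGerms.fatouComponent R ω ∧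
        ∃ n : ℕ → ℕ, StrictMono n ∧
          ∃ g : RandomGerms.Cm m → RandomGerms.Cm m,
            TendstoLocallyUniformlyOn (fun k => RandomGerms.orbit R ω (n k)) g atTop
              (RandomGerms.fatouComponent R ω) ∧
            ∀ z ∈ RandomGerms.fatouComponent R ω, ‖g z‖ ≤ r →
              RandomGerms.stableSet R ω z =
                {w ∈ RandomGerms.fatouComponent R ω | g w = g z} := by
  open RandomGerms in
  constructor
  · obtain ⟨ε, hε⟩ := HolGerm.exists_subset_range_of_isCompact hcompact
    refine ⟨ε, ε.2, fun f hf => ?_⟩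
    obtain ⟨F, rfl⟩ := hε hf
    refine ⟨extendZero F.1, F.2.1, ?_, BddHol.toGerm_isRep ε F⟩
    refine isBounded_iff_forall_norm_le.2 ⟨‖F.1‖, ?_⟩
    rintro _ ⟨z, hz, rfl⟩
    rw [extendZero_apply _ hz]
    exact F.1.norm_coe_le_norm _
  · intro R hR hbdd
    have hK : HolomorphicOnBall ν.support R := fun f hf =>
      let ⟨F, hF, _, hf⟩ := hbdd f hf
      ⟨F, hF, hf⟩
    have hsupp : ∀ᵐ ω ∂(seqLaw ν), ∀ n, ω n ∈ ν.support :=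
      ae_all_iff.2 fun n =>
        (measurePreserving_eval_infinitePi (fun _ : ℕ => ν) n).quasiMeasurePreserving.ae
          Measure.support_mem_ae
    have hstab : ∀ᵐ ω ∂(seqLaw ν), ∃ r > 0, ω ∈ stableSeq ν.support R r := by
      filter_upwards [hsupp, hfatou] with ω h1 h2 using exists_mem_stableSeq hK hR h1 h2
    -- The sets `stableSeq` grow as the radius shrinks and cover almost every `ω`, so they cannot
    -- all be null. This fixes `r` before `ω` is chosen.
    obtain ⟨r, hr, hpos⟩ : ∃ r > 0, seqLaw ν (stableSeq ν.support R (3 * r)) ≠ 0 := by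
      by_contra! hcon
      have hnull : seqLaw ν (⋃ j, stableSeq ν.support R (3 * (invRadius j : ℝ))) = 0 :=
        measure_iUnion_null fun j => hcon _ (invRadius j).2
      have hev : ∀ᵐ ω ∂(seqLaw ν), ω ∈ ⋃ j, stableSeq ν.support R (3 * (invRadius j : ℝ)) := by
        filter_upwards [hstab] with ω ⟨r, hr, hω⟩
        obtain ⟨N, hN⟩ := exists_invRadius_le ⟨r / 3, by simpa using hr⟩
        refine mem_iUnion.2 ⟨N, stableSeq_anti ?_ hω⟩
        have : (invRadius N : ℝ) ≤ r / 3 := hN N le_rfl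
        linarith
      obtain ⟨ω, h1, h2⟩ := (hev.and (measure_eq_zero_iff_ae_notMem.1 hnull)).exists
      exact h2 h1
    refine ⟨r, hr, ?_⟩
    filter_upwards [hsupp, hstab, ae_frequently_shift_mem ν (measurableSet_stableSeq
      Measure.isClosed_support.measurableSet hK hR _) hpos] with ω h1 ⟨s, hs, h2⟩ h3
    exact ⟨zero_mem_fatouComponent hR hs h2, exists_limit_stableSet_eq hK hR h1 hr h3⟩
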